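/- Let $n\ge 3$ be an odd integer and let $d,R\in\mathbb Q$ with $d\ne 0$ and $R$ not the square of a rational number. Put $D=d^2-R$ and let $$f_n=f_n(Z,d,R)=\sqrt D^{\,n}F_n(Z/\sqrt D)-2dD^{(n-1)/2}\in\mathbb Q[Z],\qquad F_n(Z)=2T_n(Z/2),$$ be the De Moivre polynomial, where $T_n$ is the $n$th Chebyshev polynomial of the first kind. (Equivalently, the first term $\sqrt D^{\,n}F_n(Z/\sqrt D)$ is the $n$th Dickson polynomial of the first kind with parameter $D$.) Write $R=s^2R'$ with $s\in\mathbb Q$ and $R'\in\mathbb Z$ square-free, let $\zeta_n\in\mathbb C$ be a primitive $n$th root of unity, and let $L\subseteq\mathbb C$ be the splitting field of $f_n$ over $\mathbb Q$. Suppose that $f_n$ is irreducible in $\mathbb Q[Z]$ and that $R'\ne -3$ if $3\mid n$. (a) If it is not the case that both $R'<0$ and $\sqrt{R'}\in\mathbb Q(\zeta_n)$, then $\mathrm{Gal}(L/\mathbb Q)$ is isomorphic to the semidirect product $(\mathbb Z/n\mathbb Z)\rtimes(\mathbb Z/n\mathbb Z)^\times$, where the units act on $\mathbb Z/n\mathbb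 Z$ by multiplication. (b) If $R'<0$ and $\sqrt{R'}\in\mathbb Q(\zeta_n)$, then $\mathrm{Gal}(L/\mathbb Q)$ is isomorphic to a semidirect product $(\mathbb Z/n\mathbb Z)\rtimes\bigl((\mathbb Z/n\mathbb Z)^\times/\{\pm1\}\bigr)$. Here the action is $c\cdot x=t(c)x$ for some group homomorphism $t:(\mathbb Z/n\mathbb Z)^\times/\{\pm1\}\to(\mathbb Z/n\mathbb Z)^\times$ such that $t(c)$ lies in the class $c$ for every $c$. -/

import Mathlib

open Polynomial

/-- The De Moivre polynomial `f_n(Z, d, R) = √D ^ n * F_n(Z / √D) - 2 d D ^ ((n - 1) / 2)`, where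
`D = d ^ 2 - R`, `F_n(Z) = 2 T_n(Z / 2)` and `T_n` is the Chebyshev polynomial of the first kind.
Its first term is the Dickson polynomial of the first kind with parameter `D`, which has rational
coefficients; the lemma `map_deMoivre` below is the formula with `√D`. -/
noncomputable def deMoivre (n : ℕ) (d R : ℚ) : ℚ[X] :=
  dickson 1 (d ^ 2 - R) n - C (2 * d * (d ^ 2 - R) ^ ((n - 1) / 2))

/-- `D_n(Z, r ^ 2) = r ^ n * F_n(Z / r)`, with `F_n(Z) = 2 T_n(Z / 2)`. -/
theorem dickson_sq_eq {K : Type*} [Field K] [CharZero K] (r : K) (hr : r ≠ 0) (n : ℕ) :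
    dickson 1 (r ^ 2) n =
      C (r ^ n) * (C 2 * (Chebyshev.T K n).comp (C (1 / 2) * (C (1 / r) * X))) := by
  have h2 : (C (2 : K)) * C (1 / 2) = 1 := by rw [← C_mul]; simp
  have h22 : (C (2 : K)) = 2 := map_ofNat C 2
  have hC : C r * C (1 / r) = 1 := by rw [← C_mul]; simp [hr]
  induction n using Nat.twoStepInduction with
  | zero =>
    simp [dickson_zero]
    rw [h22]
    norm_num
  | one =>
    simp only [dickson_one, pow_one, Nat.cast_one, Chebyshev.T_one, X_comp]
    linear_combination (-(C r * C (1 / r) * X)) * h2 - X * hC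
  | more n ih1 ih2 =>
    have hT : Chebyshev.T K ((n + 2 : ℕ) : ℤ) =
        2 * X * Chebyshev.T K ((n + 1 : ℕ) : ℤ) - Chebyshev.T K (n : ℤ) := by
      push_cast
      exact Chebyshev.T_add_two K n
    rw [dickson_add_two, ih1, ih2, hT]
    simp only [sub_comp, mul_comp, X_comp, ofNat_comp, C_pow, Nat.cast_ofNat]
    rw [h22] at h2 ⊢
    generalize (Chebyshev.T K ((n + 1 : ℕ) : ℤ)).comp (C (1 / 2) * (C (1 / r) * X)) = A
    generalize (Chebyshev.T K (n : ℤ)).comp (C (1 / 2) * (C (1 / r) * X)) = B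
    linear_combination (-(C r ^ (n + 2) * 2 * C (1 / r) * X * A)) * h2 -
      (C r ^ (n + 1) * 2 * X * A) * hC

/-- The defining formula of the De Moivre polynomial, for any square root `r` of `D` in `ℂ`. -/
theorem map_deMoivre (n : ℕ) (d R : ℚ) (r : ℂ) (hr : r ^ 2 = ((d ^ 2 - R : ℚ) : ℂ))
    (hD : d ^ 2 - R ≠ 0) :
    (deMoivre n d R).map (algebraMap ℚ ℂ) =
      C (r ^ n) * (C 2 * (Chebyshev.T ℂ n).comp (C (1 / 2) * (C (1 / r) * X))) -
        C ((2 * d * (d ^ 2 - R) ^ ((n - 1) / 2) : ℚ) : ℂ) := by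
  have h0 : r ≠ 0 := by
    rintro rfl
    apply hD
    have : ((d ^ 2 - R : ℚ) : ℂ) = 0 := by rw [← hr]; simp
    exact_mod_cast this
  rw [← dickson_sq_eq r h0, hr]
  simp only [deMoivre, Polynomial.map_sub, map_dickson, Polynomial.map_C, eq_ratCast]

/-- The splitting field of a rational polynomial inside `ℂ`. -/
noncomputable abbrev splittingFieldIn (f : ℚ[X]) : IntermediateField ℚ ℂ :=
  IntermediateField.adjoin ℚ (f.rootSet ℂ)

/-- The units of `ℤ/nℤ` acting by multiplication on the additive group `ℤ/nℤ` (which is written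
multiplicatively as `Multiplicative (ZMod n)`). -/
def unitsAct (n : ℕ) : (ZMod n)ˣ →* MulAut (Multiplicative (ZMod n)) where
  toFun a := AddEquiv.toMultiplicative (DistribMulAction.toAddEquiv (ZMod n) a)
  map_one' := by ext x; simp
  map_mul' a b := by ext x; simp [mul_smul]

theorem unitsAct_apply (n : ℕ) (a : (ZMod n)ˣ) (x : ZMod n) :
    unitsAct n a (Multiplicative.ofAdd x) = Multiplicative.ofAdd ((a : ZMod n) * x) := rfl

/-!
Put `D = d ^ 2 - R` and choose `u` with `u ^ n = D ^ ((n - 1) / 2) * (d + √R)` and `v = D / u`. Since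
`D_n(x + y) = x ^ n + y ^ n` for the Dickson polynomial with parameter `D = x * y`, the roots of
`f_n` are the elements `r k = ζ ^ k * u + ζ ^ (-k) * v` for `k` in `ℤ/nℤ`, and they are distinct
because `√R ≠ 0`. An automorphism of the algebraic numbers with `ζ ↦ ζ ^ a` and `√R ↦ ε * √R` sends
`r k` to `r (b + ε * a * k)` for some `b` (`exists_map_unityRoot`), so the Galois group is a group
`H` of affine maps of `ℤ/nℤ`. It is transitive, as `f_n` is irreducible.

The group `H` contains all translations. Otherwise there is a maximal ideal `I` of `ℤ/nℤ` such that
all linear parts `ε * a` are `1` modulo `I`: this is a fact about transitive groups of affine maps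
(`AffineZMod.translations_mem_or`). Taking `a = 2` gives `3 ∈ I`, hence `3 ∣ n`, and then `a` and
`ε` agree modulo `3` for every automorphism. This means that `√R'` and `√-3` change sign together,
so `√R' * √-3` is rational and `R' = -3` (`three_dvd_and_exists_sq_eq`, `eq_neg_three_of_sq_eq`).

Therefore `H` is determined by its group `T` of linear parts. As `a` is arbitrary, `T` contains `x`
or `-x` for each unit `x`. If `-1 ∈ T`, then `T` consists of all units. If not, then `T` is a
complement of `{±1}`, that is, the image of a section of the quotient map. Finally `-1 ∈ T` holds
unless `R' < 0` and `√R' ∈ ℚ(ζ)`: use complex conjugation, with `a = -1`, if `√R'` is real, and an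
automorphism with `a = 1` and `ε = -1` if `√R' ∉ ℚ(ζ)`. In the remaining case `ε` is determined by
`a`, and `ε = -1` for `a = -1`, so `-1` is not of the form `ε * a`.
-/

/-! ### Affine transformations of `ℤ/nℤ` -/

/-- The affine group of `ℤ/nℤ`, as the semidirect product in which the pair `(b, a)` stands for
`k ↦ b + a * k`. -/
abbrev AffineZMod (n : ℕ) : Type := Multiplicative (ZMod n) ⋊[unitsAct n] (ZMod n)ˣ

namespace AffineZMod

variable {n : ℕ}

/-- The affine map `k ↦ b + a * k` attached to the pair `(b, a)`. -/
def eval (g : AffineZMod n) (k : ZMod n) : ZMod n := g.left.toAdd + g.right * k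

@[simp] lemma eval_one (k : ZMod n) : eval 1 k = k := by simp [eval]

lemma left_mul (g h : AffineZMod n) :
    (g * h).left.toAdd = g.left.toAdd + g.right * h.left.toAdd := rfl

@[simp] lemma eval_mul (g h : AffineZMod n) (k : ZMod n) : eval (g * h) k = eval g (eval h k) := by
  simp only [eval, left_mul, SemidirectProduct.mul_right, Units.val_mul]
  ring

lemma ext_of_eval {g h : AffineZMod n} (H : ∀ k, eval g k = eval h k) : g = h := by
  have h0 : g.left.toAdd = h.left.toAdd := by simpa [eval] using H 0
  refine SemidirectProduct.ext h0 (Units.ext ?_)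
  simpa [eval, h0] using H 1

/-- A group that permutes an injective family indexed by `ℤ/nℤ` through affine maps of the index
maps to the affine group. -/
lemma exists_hom {G X : Type*} [Group G] [MulAction G X] (r : ZMod n → X)
    (hr : Function.Injective r) (h : ∀ σ : G, ∃ g : AffineZMod n, ∀ k, σ • r k = r (eval g k)) :
    ∃ ψ : G →* AffineZMod n, ∀ σ k, σ • r k = r (eval (ψ σ) k) := by
  choose ψ hψ using h
  refine ⟨MonoidHom.mk' ψ fun σ τ => ext_of_eval fun k => hr ?_, hψ⟩
  rw [eval_mul, ← hψ, ← hψ, ← hψ, mul_smul]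

/-- A transitive group of affine maps contains all translations, unless its linear parts are all
trivial modulo some maximal ideal `I`. Indeed, if the translations in `H` lie in `I`, then so do
those by commutators, that is, `H` acts on the field `ZMod n ⧸ I` through commuting affine maps.
A fixed point of one map with nontrivial linear part would then be fixed by all of `H`. -/
lemma translations_mem_or (H : Subgroup (AffineZMod n))
    (htrans : ∀ k l, ∃ g ∈ H, eval g k = l) :
    (∀ b, (SemidirectProduct.inl b : AffineZMod n) ∈ H) ∨
      ∃ I : Ideal (ZMod n), I.IsMaximal ∧ ∀ g ∈ H, ((g.right : (ZMod n)ˣ) : ZMod n) - 1 ∈ I := by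
  let N : Ideal (ZMod n) := AddSubgroup.toZModSubmodule n
    (Subgroup.toAddSubgroup' (H.comap SemidirectProduct.inl))
  have hN : ∀ b : ZMod n, b ∈ N ↔
      (SemidirectProduct.inl (Multiplicative.ofAdd b) : AffineZMod n) ∈ H := fun b => Iff.rfl
  by_cases hT : N = ⊤
  · left
    intro b
    exact (hN b.toAdd).1 (hT ▸ Submodule.mem_top)
  right
  obtain ⟨I, hI, hNI⟩ := Ideal.exists_le_maximal N hT
  refine ⟨I, hI, ?_⟩
  have hcomm : ∀ g ∈ H, ∀ h ∈ H,
      (1 - (h.right : ZMod n)) * g.left.toAdd - (1 - (g.right : ZMod n)) * h.left.toAdd ∈ I := by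
    intro g hg h hh
    apply hNI
    rw [hN]
    convert H.mul_mem (H.mul_mem hg hh) (H.inv_mem (H.mul_mem hh hg)) using 1
    rw [eq_mul_inv_iff_mul_eq]
    apply ext_of_eval
    intro k
    simp only [eval, left_mul, SemidirectProduct.mul_right, Units.val_mul,
      SemidirectProduct.left_inl, SemidirectProduct.right_inl, Units.val_one, toAdd_ofAdd]
    ring
  by_contra! hcon
  obtain ⟨h, hh, hh1⟩ := hcon
  -- `c` is a fixed point of `h` modulo `I`.
  obtain ⟨c, hc⟩ : ∃ c, (1 - (h.right : ZMod n)) * c - h.left.toAdd ∈ I := by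
    obtain ⟨y, i, hi, hyi⟩ := hI.exists_inv hh1
    refine ⟨-y * h.left.toAdd, ?_⟩
    convert I.mul_mem_left (-h.left.toAdd) hi using 1
    linear_combination h.left.toAdd * hyi
  obtain ⟨g, hg, hgc⟩ := htrans c (c + 1)
  have h1 := hcomm g hg h hh
  simp only [eval] at hgc
  have h2 : ((h.right : ZMod n) - 1) * 1 ∈ I := by
    convert I.add_mem (I.neg_mem h1) (I.mul_mem_left (1 - (g.right : ZMod n)) hc) using 1
    linear_combination (1 - (h.right : ZMod n)) * hgc
  exact hh1 (by simpa using h2)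

lemma mem_iff_right_mem {H : Subgroup (AffineZMod n)}
    (hb : ∀ b, (SemidirectProduct.inl b : AffineZMod n) ∈ H) (g : AffineZMod n) :
    g ∈ H ↔ g.right ∈ H.map SemidirectProduct.rightHom := by
  refine ⟨fun h => ⟨g, h, rfl⟩, ?_⟩
  rintro ⟨h, hh, hgh⟩
  have : g = SemidirectProduct.inl (g.left * h.left⁻¹) * h := by
    refine SemidirectProduct.ext (by simp) ?_
    simpa using hgh.symm
  rw [this]
  exact H.mul_mem (hb _) hh

end AffineZMod

/-- A subgroup `T` of `(ℤ/nℤ)ˣ` that meets `{±1}` trivially and generates everything together with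
`-1` is the image of a section of the quotient map by `{±1}`. -/
lemma exists_section_of_neg_one_notMem {n : ℕ} (T : Subgroup (ZMod n)ˣ)
    (hT : ∀ x, x ∈ T ∨ -x ∈ T) (h1 : (-1 : (ZMod n)ˣ) ∉ T) :
    ∃ t : (ZMod n)ˣ ⧸ Subgroup.zpowers (-1 : (ZMod n)ˣ) →* (ZMod n)ˣ,
      (∀ a, (QuotientGroup.mk (t a) : (ZMod n)ˣ ⧸ Subgroup.zpowers (-1 : (ZMod n)ˣ)) = a) ∧
      t.range = T := by
  let q : T →* (ZMod n)ˣ ⧸ Subgroup.zpowers (-1 : (ZMod n)ˣ) :=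
    (QuotientGroup.mk' _).comp T.subtype
  have hinj : Function.Injective q := by
    rw [injective_iff_map_eq_one]
    rintro ⟨x, hx⟩ hqx
    obtain ⟨m, rfl⟩ : x ∈ Subgroup.zpowers (-1 : (ZMod n)ˣ) := (QuotientGroup.eq_one_iff x).1 hqx
    rcases m.even_or_odd with hm | hm
    · exact Subtype.ext hm.neg_one_zpow
    · simp only [hm.neg_one_zpow] at hx
      exact absurd hx h1
  have hsurj : Function.Surjective q := by
    intro c
    obtain ⟨x, rfl⟩ := QuotientGroup.mk_surjective c
    rcases hT x with h | h
    · exact ⟨⟨x, h⟩, rfl⟩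
    · refine ⟨⟨-x, h⟩, QuotientGroup.eq.2 ?_⟩
      simp
  let Q := MulEquiv.ofBijective q ⟨hinj, hsurj⟩
  refine ⟨T.subtype.comp Q.symm.toMonoidHom, fun a => Q.apply_symm_apply a, ?_⟩
  rw [MonoidHom.range_comp, MonoidHom.range_eq_top.2 Q.symm.surjective, ← MonoidHom.range_eq_map,
    T.range_subtype]

namespace AffineZMod

variable {n : ℕ}

/-- A group of affine maps with all translations is the semidirect product of `ℤ/nℤ` by any group
that maps isomorphically to its group of linear parts. -/
lemma nonempty_mulEquiv {H : Subgroup (AffineZMod n)}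
    (hb : ∀ b, (SemidirectProduct.inl b : AffineZMod n) ∈ H)
    {C : Type*} [Group C] (t : C →* (ZMod n)ˣ) (ht : Function.Injective t)
    (hr : t.range = H.map SemidirectProduct.rightHom) :
    Nonempty (H ≃* Multiplicative (ZMod n) ⋊[(unitsAct n).comp t] C) := by
  let m : Multiplicative (ZMod n) ⋊[(unitsAct n).comp t] C →* AffineZMod n :=
    SemidirectProduct.map (MonoidHom.id _) t (fun _ => rfl)
  have hm : Function.Injective m := by
    intro x y hxy
    refine SemidirectProduct.ext ?_ (ht ?_)
    · simpa [m] using congrArg SemidirectProduct.left hxy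
    · simpa [m] using congrArg SemidirectProduct.right hxy
  have hmr : m.range = H := by
    ext g
    rw [mem_iff_right_mem hb, ← hr]
    constructor
    · rintro ⟨x, rfl⟩
      exact ⟨x.right, by simp [m]⟩
    · rintro ⟨c, hc⟩
      exact ⟨⟨g.left, c⟩, SemidirectProduct.ext (by simp [m]) (by simpa [m] using hc)⟩
  exact ⟨((MonoidHom.ofInjective hm).trans (MulEquiv.subgroupCongr hmr)).symm⟩

end AffineZMod

/-! ### The roots of the De Moivre polynomial -/

lemma eval_add_dickson_one {S : Type*} [CommRing S] (x y : S) (n : ℕ) :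
    (dickson 1 (x * y) n).eval (x + y) = x ^ n + y ^ n := by
  induction n using Nat.twoStepInduction with
  | zero => simp [dickson_zero]; norm_num
  | one => simp
  | more n ih1 ih2 =>
    rw [dickson_add_two, eval_sub, eval_mul, eval_mul, ih1, ih2, eval_X, eval_C]
    ring

lemma aeval_add_deMoivre {Ω : Type*} [Field Ω] [Algebra ℚ Ω] {n : ℕ} {d R : ℚ} {x y : Ω}
    (hxy : x * y = algebraMap ℚ Ω (d ^ 2 - R)) :
    aeval (x + y) (deMoivre n d R) =
      x ^ n + y ^ n - algebraMap ℚ Ω (2 * d * (d ^ 2 - R) ^ ((n - 1) / 2)) := by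
  rw [deMoivre, aeval_def, eval₂_eq_eval_map, Polynomial.map_sub, map_dickson, ← hxy, map_C,
    eval_sub, eval_C, eval_add_dickson_one]

/-- The family `e k * u + e (-k) * v`, where `e` runs over the `n`th roots of unity. It consists of
the roots of the De Moivre polynomial for suitable `u` and `v` with `u * v = d ^ 2 - R`. -/
def unityRoot {Ω : Type*} [Field Ω] {n : ℕ} (e : AddChar (ZMod n) Ω) (u v : Ω) (k : ZMod n) : Ω :=
  e k * u + e (-k) * v

section UnityRoot

variable {Ω : Type*} [Field Ω] {n : ℕ} {e : AddChar (ZMod n) Ω}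

lemma AddChar.zmod_pow_eq_one (k : ZMod n) : e k ^ n = 1 := by
  rw [← AddChar.map_nsmul_eq_pow]
  simp

lemma exists_eq_mul_of_pow_eq (hsurj : ∀ x : Ω, x ^ n = 1 → ∃ k, e k = x)
    {x u : Ω} (hu : u ≠ 0) (h : x ^ n = u ^ n) : ∃ k, x = e k * u := by
  obtain ⟨k, hk⟩ := hsurj (x / u) (by rw [div_pow, h, div_self (pow_ne_zero _ hu)])
  exact ⟨k, by rw [hk, div_mul_cancel₀ _ hu]⟩

lemma isPrimitiveRoot_addChar_unit (hinj : Function.Injective e) (x : (ZMod n)ˣ) :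
    IsPrimitiveRoot (e x) n := by
  refine ⟨AddChar.zmod_pow_eq_one _, fun l hl => ?_⟩
  rw [← AddChar.map_nsmul_eq_pow, ← AddChar.map_zero_eq_one e] at hl
  have := hinj hl
  rw [nsmul_eq_mul, Units.mul_left_eq_zero] at this
  exact (ZMod.natCast_eq_zero_iff _ _).1 this

variable [NeZero n]

lemma AddChar.zmod_apply_ne_zero (k : ZMod n) : e k ≠ 0 := fun h => by
  simpa [h, NeZero.ne n] using AddChar.zmod_pow_eq_one (e := e) k

lemma unityRoot_injective (hinj : Function.Injective e) {u v : Ω} (huv : u ^ n ≠ v ^ n) :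
    Function.Injective (unityRoot e u v) := by
  intro k l h
  have hk := AddChar.zmod_apply_ne_zero (e := e) k
  have hl := AddChar.zmod_apply_ne_zero (e := e) l
  simp only [unityRoot, AddChar.map_neg_eq_inv] at h
  have : (e k - e l) * (e k * e l * u - v) = 0 := by
    field_simp at h
    linear_combination h
  rcases mul_eq_zero.1 this with h1 | h1
  · exact hinj (sub_eq_zero.1 h1)
  · refine absurd ?_ huv
    rw [← sub_eq_zero.1 h1, mul_pow, mul_pow, AddChar.zmod_pow_eq_one, AddChar.zmod_pow_eq_one]
    ring

variable (hsurj : ∀ x : Ω, x ^ n = 1 → ∃ k, e k = x)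
include hsurj

lemma exists_unityRoot_of_add_eq {u v x y : Ω} (hu : u ≠ 0) (hv : v ≠ 0) (hxy : x * y = u * v)
    (h : x ^ n + y ^ n = u ^ n + v ^ n) : ∃ k, unityRoot e u v k = x + y := by
  have hprod : (x ^ n - u ^ n) * (x ^ n - v ^ n) = 0 := by
    have h2 : x ^ n * y ^ n = u ^ n * v ^ n := by rw [← mul_pow, hxy, mul_pow]
    linear_combination x ^ n * h - h2
  have hne : ∀ k, e k ≠ 0 := fun k => AddChar.zmod_apply_ne_zero k
  rcases mul_eq_zero.1 hprod with h1 | h1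
  · obtain ⟨k, rfl⟩ := exists_eq_mul_of_pow_eq hsurj hu (sub_eq_zero.1 h1)
    refine ⟨k, ?_⟩
    have : y = e (-k) * v := by
      rw [AddChar.map_neg_eq_inv, eq_inv_mul_iff_mul_eq₀ (hne k)]
      exact mul_left_cancel₀ hu (by linear_combination hxy)
    rw [this, unityRoot]
  · obtain ⟨k, rfl⟩ := exists_eq_mul_of_pow_eq hsurj hv (sub_eq_zero.1 h1)
    refine ⟨-k, ?_⟩
    have : y = e (-k) * u := by
      rw [AddChar.map_neg_eq_inv, eq_inv_mul_iff_mul_eq₀ (hne k)]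
      exact mul_left_cancel₀ hv (by linear_combination hxy)
    rw [this, unityRoot, neg_neg, add_comm]

lemma exists_unityRoot_of_aeval_eq_zero [IsAlgClosed Ω] [Algebra ℚ Ω] {d R : ℚ} {u v : Ω}
    (hD : d ^ 2 - R ≠ 0) (huv : u * v = algebraMap ℚ Ω (d ^ 2 - R))
    (hsum : u ^ n + v ^ n = algebraMap ℚ Ω (2 * d * (d ^ 2 - R) ^ ((n - 1) / 2)))
    {z : Ω} (hz : aeval z (deMoivre n d R) = 0) : ∃ k, unityRoot e u v k = z := by
  have huv0 : u * v ≠ 0 := by rw [huv]; exact (_root_.map_ne_zero _).2 hD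
  obtain ⟨x, hx⟩ : ∃ x : Ω, x * (z - x) = u * v := by
    have hdeg : (X ^ 2 - C z * X + C (u * v) : Polynomial Ω).degree ≠ 0 := by
      have : (X ^ 2 - C z * X + C (u * v) : Polynomial Ω).degree = 2 := by compute_degree!
      rw [this]; decide
    obtain ⟨x, hx⟩ := IsAlgClosed.exists_root _ hdeg
    refine ⟨x, ?_⟩
    simp only [IsRoot.def, eval_add, eval_sub, eval_pow, eval_X, eval_mul, eval_C] at hx
    linear_combination -hx
  have h := aeval_add_deMoivre (n := n) (hx.trans huv)
  rw [add_sub_cancel, hz, ← hsum] at h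
  obtain ⟨k, hk⟩ := exists_unityRoot_of_add_eq hsurj (left_ne_zero_of_mul huv0)
    (right_ne_zero_of_mul huv0) hx (by linear_combination -h)
  exact ⟨k, by rw [hk, add_sub_cancel]⟩

end UnityRoot

/-! ### Automorphisms acting on the roots -/

section Automorphisms

variable {Ω : Type*} [Field Ω] [Algebra ℚ Ω] {n : ℕ} [NeZero n] {e : AddChar (ZMod n) Ω}

lemma map_addChar_of_map_one (σ : Gal(Ω/ℚ)) {a : ZMod n} (h : σ (e 1) = e a) (k : ZMod n) :
    σ (e k) = e (a * k) := by
  have hk : k = k.val • (1 : ZMod n) := by simp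
  have hak : a * k = k.val • a := by simp [mul_comm]
  rw [hak, AddChar.map_nsmul_eq_pow, ← h, ← map_pow, ← AddChar.map_nsmul_eq_pow, ← hk]

lemma exists_unit_map_addChar (hinj : Function.Injective e)
    (hsurj : ∀ x : Ω, x ^ n = 1 → ∃ k, e k = x) (σ : Gal(Ω/ℚ)) :
    ∃ a : (ZMod n)ˣ, ∀ k, σ (e k) = e (a * k) := by
  have key : ∀ τ : Gal(Ω/ℚ), ∃ a : ZMod n, ∀ k, τ (e k) = e (a * k) := fun τ => by
    obtain ⟨a, ha⟩ := hsurj (τ (e 1)) (by rw [← map_pow, AddChar.zmod_pow_eq_one, map_one])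
    exact ⟨a, map_addChar_of_map_one τ ha.symm⟩
  obtain ⟨a, ha⟩ := key σ
  obtain ⟨b, hb⟩ := key σ⁻¹
  have hab : a * b = 1 := hinj (by
    rw [← mul_one b, ← ha, ← hb, ← AlgEquiv.mul_apply, mul_inv_cancel, AlgEquiv.one_apply])
  exact ⟨Units.mkOfMulEqOne a b hab, ha⟩

lemma exists_sign_map_sqrt (σ : Gal(Ω/ℚ)) {w : Ω} {q : ℚ} (hw : w ^ 2 = algebraMap ℚ Ω q) :
    ∃ ε : ℤˣ, σ w = ((ε : ℤ) : Ω) * w := by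
  have : (σ w) ^ 2 = w ^ 2 := by rw [← map_pow, hw, AlgEquiv.commutes]
  rcases sq_eq_sq_iff_eq_or_eq_neg.1 this with h | h
  · exact ⟨1, by simpa using h⟩
  · exact ⟨-1, by simpa using h⟩

/-- Irreducibility of the cyclotomic polynomial over `ℚ`. -/
lemma exists_gal_map_addChar [Normal ℚ Ω] (hinj : Function.Injective e) (x : (ZMod n)ˣ) :
    ∃ σ : Gal(Ω/ℚ), ∀ k, σ (e k) = e (x * k) := by
  have : CharZero Ω := algebraRat.charZero Ω
  have hconj : IsConjRoot ℚ (e (x : ZMod n)) (e ((1 : (ZMod n)ˣ) : ZMod n)) := by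
    have key : ∀ y : (ZMod n)ˣ, cyclotomic n ℚ = minpoly ℚ (e y) := fun y => by
      convert cyclotomic_eq_minpoly_rat (isPrimitiveRoot_addChar_unit hinj y) (NeZero.pos n)
      exact Subsingleton.elim _ _
    rw [IsConjRoot, ← key, ← key]
  obtain ⟨σ, hσ⟩ := isConjRoot_iff_exists_algEquiv.1 hconj
  exact ⟨σ, map_addChar_of_map_one σ (by simpa using hσ)⟩

/-- If `σ` fixes `w`, it multiplies `u` by a root of unity; if `σ` negates `w`, it exchanges `u`
and `v` up to roots of unity. Either way it permutes the roots by an affine map of the index. -/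
lemma exists_map_unityRoot (hsurj : ∀ x : Ω, x ^ n = 1 → ∃ k, e k = x) {u v w : Ω} {D α β : ℚ}
    (hD : D ≠ 0) (huv : u * v = algebraMap ℚ Ω D)
    (hu : u ^ n = algebraMap ℚ Ω α + algebraMap ℚ Ω β * w)
    (hv : v ^ n = algebraMap ℚ Ω α - algebraMap ℚ Ω β * w)
    {σ : Gal(Ω/ℚ)} {a : (ZMod n)ˣ} (ha : ∀ k, σ (e k) = e (a * k))
    {ε : ℤˣ} (hε : σ w = ((ε : ℤ) : Ω) * w) :
    ∃ b, ∀ k, σ (unityRoot e u v k) = unityRoot e u v (b + ((ε : ℤ) : ZMod n) * a * k) := by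
  have huv0 : u * v ≠ 0 := by rw [huv]; exact (_root_.map_ne_zero _).2 hD
  have hu0 := left_ne_zero_of_mul huv0
  have hv0 := right_ne_zero_of_mul huv0
  have hσuv : σ u * σ v = u * v := by rw [← map_mul, huv, AlgEquiv.commutes]
  have hσu : (σ u) ^ n = algebraMap ℚ Ω α + algebraMap ℚ Ω β * (((ε : ℤ) : Ω) * w) := by
    rw [← map_pow, hu, map_add, map_mul, AlgEquiv.commutes, AlgEquiv.commutes, hε]
  have hne : ∀ k, e k ≠ 0 := fun k => AddChar.zmod_apply_ne_zero k
  rcases Int.units_eq_one_or ε with rfl | rfl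
  · obtain ⟨b, hb⟩ := exists_eq_mul_of_pow_eq hsurj hu0 (x := σ u) (by rw [hσu, hu]; simp)
    have hb' : σ v = e (-b) * v := by
      rw [AddChar.map_neg_eq_inv, eq_inv_mul_iff_mul_eq₀ (hne b)]
      exact mul_left_cancel₀ hu0 (by rw [← hσuv, hb]; ring)
    refine ⟨b, fun k => ?_⟩
    have h1 : b + ((1 : ℤˣ) : ℤ) * (a : ZMod n) * k = b + a * k := by simp
    rw [h1]
    simp only [unityRoot, map_add, map_mul, ha, hb, hb', neg_add, mul_neg, AddChar.map_add_eq_mul]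
    ring
  · obtain ⟨b, hb⟩ := exists_eq_mul_of_pow_eq hsurj hv0 (x := σ u) (by rw [hσu, hv]; simp; ring)
    have hb' : σ v = e (-b) * u := by
      rw [AddChar.map_neg_eq_inv, eq_inv_mul_iff_mul_eq₀ (hne b)]
      exact mul_left_cancel₀ hv0 (by linear_combination hσuv - σ v * hb)
    refine ⟨-b, fun k => ?_⟩
    have h1 : -b + (((-1 : ℤˣ) : ℤ) : ZMod n) * (a : ZMod n) * k = -b + -(a * k) := by simp
    rw [h1]
    simp only [unityRoot, map_add, map_mul, ha, hb, hb', neg_add, neg_neg, mul_neg,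
      AddChar.map_add_eq_mul]
    ring

end Automorphisms

/-! ### The exceptional field `ℚ(√-3)` -/

/-- If every automorphism changes the sign of `w` as it acts on the `n`th roots of unity modulo a
maximal ideal of `ℤ/nℤ`, then this ideal has residue characteristic `3`: the automorphism squaring
the roots of unity shows that `2 = ±1` there. So `w` transforms as `√-3` does, and `w * √-3` is
rational. -/
lemma three_dvd_and_exists_sq_eq {Ω : Type*} [Field Ω] [Algebra ℚ Ω] [IsGalois ℚ Ω] {n : ℕ}
    [NeZero n] (hodd : Odd n) {e : AddChar (ZMod n) Ω} (hinj : Function.Injective e)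
    (hsurj : ∀ x : Ω, x ^ n = 1 → ∃ k, e k = x) {w : Ω} {q : ℚ} (hw : w ^ 2 = algebraMap ℚ Ω q)
    {I : Ideal (ZMod n)} (hI : I.IsMaximal)
    (h : ∀ (σ : Gal(Ω/ℚ)) (a : (ZMod n)ˣ) (ε : ℤˣ), (∀ k, σ (e k) = e (a * k)) →
      σ w = ((ε : ℤ) : Ω) * w → ((ε : ℤ) : ZMod n) * a - 1 ∈ I) :
    3 ∣ n ∧ ∃ y : ℚ, y ^ 2 = -3 * q := by
  have hone : (1 : ZMod n) ∉ I := (Ideal.ne_top_iff_one I).1 hI.ne_top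
  have h3I : (3 : ZMod n) ∈ I := by
    obtain ⟨σ, hσ⟩ := exists_gal_map_addChar hinj
      (ZMod.unitOfCoprime 2 (Nat.coprime_two_left.2 hodd))
    obtain ⟨ε, hε⟩ := exists_sign_map_sqrt σ hw
    have := h σ _ ε hσ hε
    rcases Int.units_eq_one_or ε with rfl | rfl
    · refine absurd ?_ hone
      convert this using 1
      simp
      norm_num
    · convert I.neg_mem this using 1
      simp
      norm_num
  have hdvd : ∀ j : ℕ, (j : ZMod n) ∈ I → 3 ∣ j := by
    intro j hj
    by_contra hcon
    have hcop : IsCoprime (3 : ℤ) j := by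
      rw [show (3 : ℤ) = ((3 : ℕ) : ℤ) by rfl, Nat.isCoprime_iff_coprime]
      exact (Nat.Prime.coprime_iff_not_dvd Nat.prime_three).2 hcon
    obtain ⟨x, y, hxy⟩ := hcop
    apply hone
    have hxy' : (x : ZMod n) * 3 + y * j = 1 := by
        exact_mod_cast congrArg (Int.cast (R := ZMod n)) hxy
    rw [← hxy']
    exact I.add_mem (I.mul_mem_left _ h3I) (I.mul_mem_left _ hj)
  have h3n : 3 ∣ n := hdvd n (by simp)
  refine ⟨h3n, ?_⟩
  obtain ⟨m, hm⟩ := h3n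
  have hn0 : 0 < n := NeZero.pos n
  have hω1 : e (m : ZMod n) ≠ 1 := by
    rw [← AddChar.map_zero_eq_one e]
    intro hcon
    have := (ZMod.natCast_eq_zero_iff m n).1 (hinj hcon)
    have := Nat.le_of_dvd (by omega) this
    omega
  have hω3 : e (m : ZMod n) ^ 3 = 1 := by
    rw [← AddChar.map_nsmul_eq_pow, ← AddChar.map_zero_eq_one e]
    congr 1
    rw [nsmul_eq_mul, ← Nat.cast_mul, ← hm, ZMod.natCast_self]
  have hω2 : e (m : ZMod n) ^ 2 + e (m : ZMod n) + 1 = 0 := by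
    have : (e (m : ZMod n) - 1) * (e (m : ZMod n) ^ 2 + e (m : ZMod n) + 1) = 0 := by
      linear_combination hω3
    exact (mul_eq_zero.1 this).resolve_left (sub_ne_zero.2 hω1)
  -- `2 * e m + 1` is a square root of `-3`.
  obtain ⟨y, hy⟩ : (2 * e (m : ZMod n) + 1) * w ∈ Set.range (algebraMap ℚ Ω) := by
    rw [InfiniteGalois.mem_range_algebraMap_iff_fixed]
    intro σ
    obtain ⟨ε, hε⟩ := exists_sign_map_sqrt σ hw
    obtain ⟨a, ha⟩ := exists_unit_map_addChar hinj hsurj σ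
    have haI : (a : ZMod n) - ((ε : ℤ) : ZMod n) ∈ I := by
      convert I.mul_mem_left ((ε : ℤ) : ZMod n) (h σ a ε ha hε) using 1
      rcases Int.units_eq_one_or ε with rfl | rfl
      · simp
      · simp
        ring
    have ham : (a : ZMod n) * m = ((ε : ℤ) : ZMod n) * m := by
      rw [← ZMod.natCast_zmod_val ((a : ZMod n) - ((ε : ℤ) : ZMod n))] at haI
      obtain ⟨j, hj⟩ := hdvd _ haI
      rw [← sub_eq_zero, ← sub_mul, ← ZMod.natCast_zmod_val ((a : ZMod n) - ((ε : ℤ) : ZMod n)), hj,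
        ← Nat.cast_mul, ZMod.natCast_eq_zero_iff]
      exact ⟨j, by rw [hm]; ring⟩
    rw [map_mul, map_add, map_mul, map_one, map_ofNat, ha, ham, hε]
    rcases Int.units_eq_one_or ε with rfl | rfl
    · simp
    · have hinv : e (-(m : ZMod n)) = e (m : ZMod n) ^ 2 := by
        rw [AddChar.map_neg_eq_inv]
        exact inv_eq_of_mul_eq_one_right (by linear_combination hω3)
      simp only [Units.val_neg, Units.val_one, Int.cast_neg, Int.cast_one, neg_mul, one_mul, hinv]
      linear_combination (-2 * w) * hω2
  refine ⟨y, (algebraMap ℚ Ω).injective ?_⟩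
  rw [map_pow, hy, map_mul, ← hw, map_neg, map_ofNat]
  linear_combination (4 * w ^ 2) * hω2

lemma eq_neg_three_of_sq_eq {m : ℤ} (hm : Squarefree m) {y : ℚ} (hy : y ^ 2 = -3 * (m : ℚ)) :
    m = -3 := by
  obtain ⟨z, hz⟩ : IsSquare (-3 * m) := by
    rw [← Rat.isSquare_intCast_iff]
    exact ⟨y, by push_cast; rw [← hy, sq]⟩
  have h3 : (3 : ℤ) ∣ z := by
    have : (3 : ℤ) ∣ z * z := ⟨-m, by linarith⟩
    exact (Int.prime_three.dvd_mul.1 this).elim id id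
  obtain ⟨t, rfl⟩ := h3
  have hmt : m = -3 * (t * t) := by linarith
  have := Int.isUnit_iff.1 (hm t ⟨-3, by linarith⟩)
  rcases this with rfl | rfl <;> simpa using hmt

/-! ### The Galois group as a group of affine maps -/

lemma nonempty_gal_mulEquiv_range {F Ω : Type*} [Field F] [Field Ω] [Algebra F Ω] [Normal F Ω]
    [IsAlgClosed Ω] (f : F[X]) (E : Type*) [Field E] [Algebra F E] [f.IsSplittingField F E]
    {G : Type*} [Group G] (ψ : Gal(Ω/F) →* G)
    (hker : ∀ σ, ψ σ = 1 ↔ ∀ z ∈ f.rootSet Ω, σ z = z) :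
    Nonempty (Gal(E/F) ≃* ψ.range) := by
  let K := IntermediateField.adjoin F (f.rootSet Ω)
  have : f.IsSplittingField F K :=
    IntermediateField.adjoin_rootSet_isSplittingField (IsAlgClosed.splits _)
  have : Normal F K := Normal.of_isSplittingField f
  have hk : (AlgEquiv.restrictNormalHom (F := F) (K₁ := Ω) K).ker = ψ.ker := by
    ext σ
    rw [MonoidHom.mem_ker, MonoidHom.mem_ker, hker]
    change AlgEquiv.restrictNormal σ K = 1 ↔ _
    rw [AlgEquiv.restrictNormal_eq_one_iff]
    refine ⟨fun h z hz => h z (IntermediateField.subset_adjoin F _ hz), fun h x hx => ?_⟩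
    exact IntermediateField.forall_mem_adjoin_smul_eq_self_iff F σ |>.2 h x hx
  exact ⟨(AlgEquiv.autCongr ((IsSplittingField.algEquiv E f).trans
      (IsSplittingField.algEquiv K f).symm)).trans
    ((QuotientGroup.quotientKerEquivOfSurjective _
      (AlgEquiv.restrictNormalHom_surjective Ω)).symm.trans
      ((QuotientGroup.quotientMulEquivOfEq hk).trans
        (QuotientGroup.quotientKerEquivRange ψ)))⟩

lemma IsConjRoot.of_irreducible {F Ω : Type*} [Field F] [Field Ω] [Algebra F Ω] {f : F[X]}
    (hf : Irreducible f) {x y : Ω} (hx : aeval x f = 0) (hy : aeval y f = 0) :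
    IsConjRoot F x y := by
  rw [IsConjRoot, ← minpoly.eq_of_irreducible hf hx, ← minpoly.eq_of_irreducible hf hy]

/-- The Galois group of the De Moivre polynomial is a group `H` of affine maps that contains all
translations. An automorphism acting on the roots of unity by `a` and on `w = √m` by the sign `ε`
gives an affine map with linear part `ε * a`. -/
theorem exists_affine_subgroup {Ω : Type*} [Field Ω] [Algebra ℚ Ω] [IsAlgClosed Ω] [IsGalois ℚ Ω]
    {n : ℕ} [NeZero n] (hodd : Odd n) {d R s : ℚ} {m : ℤ} (hR : ¬ IsSquare R) (hm : Squarefree m)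
    (hsR : R = s ^ 2 * m) (hirr : Irreducible (deMoivre n d R)) (h3 : 3 ∣ n → m ≠ -3)
    (E : Type*) [Field E] [Algebra ℚ E] [(deMoivre n d R).IsSplittingField ℚ E]
    {e : AddChar (ZMod n) Ω} (hinj : Function.Injective e)
    (hsurj : ∀ x : Ω, x ^ n = 1 → ∃ k, e k = x) {w : Ω} (hw : w ^ 2 = algebraMap ℚ Ω m) :
    ∃ H : Subgroup (AffineZMod n), Nonempty (Gal(E/ℚ) ≃* H) ∧
      (∀ b, (SemidirectProduct.inl b : AffineZMod n) ∈ H) ∧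
      ∀ x : (ZMod n)ˣ, x ∈ H.map SemidirectProduct.rightHom ↔
        ∃ (σ : Gal(Ω/ℚ)) (a : (ZMod n)ˣ) (ε : ℤˣ), (∀ k, σ (e k) = e (a * k)) ∧
          σ w = ((ε : ℤ) : Ω) * w ∧ (x : ZMod n) = ((ε : ℤ) : ZMod n) * a := by
  have hD : d ^ 2 - R ≠ 0 := fun h => hR ⟨d, by linarith⟩
  set D := d ^ 2 - R with hDdef
  have hs : s ≠ 0 := by
    rintro rfl
    exact hR ⟨0, by rw [hsR]; simp⟩
  have hm0 : (m : ℚ) ≠ 0 := by exact_mod_cast hm.ne_zero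
  have hw0 : w ≠ 0 := by
    rintro rfl
    rw [zero_pow two_ne_zero, eq_comm, _root_.map_eq_zero] at hw
    exact hm0 hw
  -- `u ^ n = D ^ ((n - 1) / 2) * (d + √R)` and `v = D / u`.
  set c : ℚ := D ^ ((n - 1) / 2) with hc
  have hc0 : c ≠ 0 := pow_ne_zero _ hD
  obtain ⟨u, hu⟩ : ∃ u : Ω, u ^ n = algebraMap ℚ Ω (c * d) + algebraMap ℚ Ω (c * s) * w :=
    IsAlgClosed.exists_pow_nat_eq _ (NeZero.pos n)
  have hnorm : (algebraMap ℚ Ω (c * d) + algebraMap ℚ Ω (c * s) * w) *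
      (algebraMap ℚ Ω (c * d) - algebraMap ℚ Ω (c * s) * w) = algebraMap ℚ Ω D ^ n := by
    have h1 : D ^ n = c ^ 2 * D := by
      obtain ⟨j, rfl⟩ := hodd
      rw [hc, Nat.add_sub_cancel, Nat.mul_div_cancel_left _ two_pos]
      ring
    rw [← map_pow, h1, hDdef, hsR]
    simp only [map_mul, map_sub, map_pow, ← hw]
    ring
  have hDΩ : algebraMap ℚ Ω D ≠ 0 := (_root_.map_ne_zero _).2 hD
  have hun : u ^ n ≠ 0 := by
    rw [hu]
    exact left_ne_zero_of_mul (hnorm ▸ pow_ne_zero n hDΩ)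
  have hu0 : u ≠ 0 := fun h => hun (by rw [h, zero_pow (NeZero.ne n)])
  obtain ⟨v, huv⟩ : ∃ v, u * v = algebraMap ℚ Ω D := ⟨_, mul_div_cancel₀ _ hu0⟩
  have hv : v ^ n = algebraMap ℚ Ω (c * d) - algebraMap ℚ Ω (c * s) * w :=
    mul_left_cancel₀ hun (by rw [← mul_pow, huv, ← hnorm, hu])
  have hne : u ^ n ≠ v ^ n := by
    rw [hu, hv]
    intro h
    have h2 : algebraMap ℚ Ω (2 * (c * s)) * w = 0 := by
      rw [map_mul, map_ofNat]
      linear_combination h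
    rcases mul_eq_zero.1 h2 with h2 | h2
    · rw [_root_.map_eq_zero] at h2
      simp [hc0, hs] at h2
    · exact hw0 h2
  have hsum : u ^ n + v ^ n = algebraMap ℚ Ω (2 * d * D ^ ((n - 1) / 2)) := by
    rw [hu, hv, ← hc]
    simp only [map_mul, map_ofNat]
    ring
  have hrinj := unityRoot_injective hinj hne
  have hroot : ∀ k, aeval (unityRoot e u v k) (deMoivre n d R) = 0 := by
    intro k
    rw [unityRoot, aeval_add_deMoivre, mul_pow, mul_pow, AddChar.zmod_pow_eq_one,
      AddChar.zmod_pow_eq_one, one_mul, one_mul, hsum, sub_self]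
    rw [mul_mul_mul_comm, ← AddChar.map_add_eq_mul, add_neg_cancel, AddChar.map_zero_eq_one, one_mul,
      huv]
  obtain ⟨ψ, hψ⟩ := AffineZMod.exists_hom (G := Gal(Ω/ℚ)) _ hrinj fun σ => by
    obtain ⟨ε, hε⟩ := exists_sign_map_sqrt σ hw
    obtain ⟨a, ha⟩ := exists_unit_map_addChar hinj hsurj σ
    obtain ⟨b, hb⟩ := exists_map_unityRoot hsurj hD huv hu hv ha hε
    refine ⟨⟨Multiplicative.ofAdd b, Units.map (Int.castRingHom (ZMod n)).toMonoidHom ε * a⟩, ?_⟩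
    intro k
    exact hb k
  have hright : ∀ (σ : Gal(Ω/ℚ)) (a : (ZMod n)ˣ) (ε : ℤˣ), (∀ k, σ (e k) = e (a * k)) →
      σ w = ((ε : ℤ) : Ω) * w → ((ψ σ).right : ZMod n) = ((ε : ℤ) : ZMod n) * a := by
    intro σ a ε ha hε
    obtain ⟨b, hb⟩ := exists_map_unityRoot hsurj hD huv hu hv ha hε
    have h : ∀ k, (ψ σ).eval k = b + ((ε : ℤ) : ZMod n) * a * k := fun k =>
      hrinj ((hψ σ k).symm.trans (hb k))
    have h0 := h 0
    have h1 := h 1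
    simp only [AffineZMod.eval, mul_zero, add_zero, mul_one] at h0 h1
    rwa [h0, add_right_inj] at h1
  refine ⟨ψ.range, nonempty_gal_mulEquiv_range (Ω := Ω) (deMoivre n d R) E ψ fun σ => ?_, ?_,
    fun x => ?_⟩
  · constructor
    · intro h z hz
      obtain ⟨k, rfl⟩ := exists_unityRoot_of_aeval_eq_zero hsurj hD huv hsum
        ((mem_rootSet.1 hz).2)
      simpa [h] using hψ σ k
    · intro h
      refine AffineZMod.ext_of_eval fun k => hrinj ?_
      rw [← hψ, AffineZMod.eval_one]
      exact h _ (mem_rootSet.2 ⟨hirr.ne_zero, hroot k⟩)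
  · refine (AffineZMod.translations_mem_or ψ.range fun k l => ?_).resolve_right ?_
    · obtain ⟨σ, hσ⟩ := isConjRoot_iff_exists_algEquiv.1
        (IsConjRoot.of_irreducible hirr (hroot l) (hroot k))
      exact ⟨ψ σ, ⟨σ, rfl⟩, hrinj (by rw [← hψ]; exact hσ)⟩
    · rintro ⟨I, hI, hHI⟩
      obtain ⟨hn3, y, hy⟩ := three_dvd_and_exists_sq_eq hodd hinj hsurj hw hI
        fun σ a ε ha hε => by
          rw [← hright σ a ε ha hε]
          exact hHI _ ⟨σ, rfl⟩
      exact h3 hn3 (eq_neg_three_of_sq_eq hm hy)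
  · constructor
    · rintro ⟨_, ⟨σ, rfl⟩, rfl⟩
      obtain ⟨ε, hε⟩ := exists_sign_map_sqrt σ hw
      obtain ⟨a, ha⟩ := exists_unit_map_addChar hinj hsurj σ
      exact ⟨σ, a, ε, ha, hε, hright σ a ε ha hε⟩
    · rintro ⟨σ, a, ε, ha, hε, hx⟩
      exact ⟨ψ σ, ⟨σ, rfl⟩, Units.ext ((hright σ a ε ha hε).trans hx.symm)⟩

/-! ### Square roots of rationals in the cyclotomic field, and complex conjugation -/

lemma exists_gal_fix_ne_of_notMem_adjoin {F Ω : Type*} [Field F] [Field Ω] [Algebra F Ω]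
    [IsGalois F Ω] {S : Set Ω} {x : Ω} (hx : x ∉ IntermediateField.adjoin F S) :
    ∃ σ : Gal(Ω/F), (∀ z ∈ S, σ z = z) ∧ σ x ≠ x := by
  by_contra! hcon
  apply hx
  rw [← InfiniteGalois.fixedField_fixingSubgroup (IntermediateField.adjoin F S)]
  rintro ⟨σ, hσ⟩
  exact hcon σ fun z hz => hσ ⟨z, IntermediateField.subset_adjoin F S hz⟩

lemma Complex.conj_eq_self_or_neg_of_sq_eq {w : ℂ} {m : ℝ} (hw : w ^ 2 = m) :
    (0 < m → starRingEnd ℂ w = w) ∧ (m < 0 → starRingEnd ℂ w = -w) := by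
  have hre : w.re ^ 2 - w.im ^ 2 = m := by
    have := congrArg Complex.re hw
    simp only [sq, Complex.mul_re, Complex.ofReal_re] at this
    linarith
  have him : w.re = 0 ∨ w.im = 0 := by
    have := congrArg Complex.im hw
    simp only [sq, Complex.mul_im, Complex.ofReal_im] at this
    exact mul_eq_zero.1 (by linarith)
  constructor
  · intro hm
    have : w.im = 0 := him.resolve_left fun h => by
      rw [h] at hre
      nlinarith [sq_nonneg w.im]
    exact Complex.conj_eq_iff_im.2 this
  · intro hm
    have : w.re = 0 := him.resolve_right fun h => by
      rw [h] at hre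
      nlinarith [sq_nonneg w.re]
    apply Complex.ext <;> simp [this]

/-- The linear parts of the Galois group exhaust `(ℤ/nℤ)ˣ` up to sign, and contain `-1` unless `√m`
is an imaginary element of `ℚ(ζ)`. The unit `-1` arises in two ways: from complex conjugation if
`√m` is real, and from an automorphism that fixes `ζ` and negates `√m` if `√m ∉ ℚ(ζ)`. -/
theorem exists_affine_subgroup_of_embedding {Ω : Type*} [Field Ω] [Algebra ℚ Ω] [IsAlgClosed Ω]
    [IsGalois ℚ Ω] (i : Ω →ₐ[ℚ] ℂ) {c : Gal(Ω/ℚ)} (hcC : ∀ x, i (c x) = starRingEnd ℂ (i x))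
    {n : ℕ} [NeZero n] (hodd : Odd n) {d R s : ℚ} {m : ℤ} (hR : ¬ IsSquare R) (hm : Squarefree m)
    (hsR : R = s ^ 2 * m) (hirr : Irreducible (deMoivre n d R)) (h3 : 3 ∣ n → m ≠ -3)
    (E : Type*) [Field E] [Algebra ℚ E] [(deMoivre n d R).IsSplittingField ℚ E]
    {ξ : Ω} (hξ : IsPrimitiveRoot ξ n) :
    ∃ H : Subgroup (AffineZMod n), Nonempty (Gal(E/ℚ) ≃* H) ∧
      (∀ b, (SemidirectProduct.inl b : AffineZMod n) ∈ H) ∧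
      (∀ x, x ∈ H.map SemidirectProduct.rightHom ∨ -x ∈ H.map SemidirectProduct.rightHom) ∧
      (-1 ∈ H.map SemidirectProduct.rightHom ↔
        ¬ (m < 0 ∧ ∃ w ∈ IntermediateField.adjoin ℚ {i ξ}, w ^ 2 = (m : ℂ))) := by
  have hi : Function.Injective i := i.injective
  obtain ⟨w, hw⟩ : ∃ w : Ω, w ^ 2 = algebraMap ℚ Ω m := IsAlgClosed.exists_pow_nat_eq _ two_pos
  have hwC : i w ^ 2 = (m : ℂ) := by
    rw [← map_pow, hw, AlgHom.commutes]
    simp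
  have hw0 : w ≠ -w := by
    intro h
    have hw0 : i w = 0 := self_eq_neg.1 (by rw [← map_neg, ← h])
    have : (m : ℂ) = 0 := by simpa [hw0] using hwC.symm
    exact hm.ne_zero (by exact_mod_cast this)
  have hmem : (∃ w ∈ IntermediateField.adjoin ℚ {i ξ}, w ^ 2 = (m : ℂ)) ↔
      w ∈ IntermediateField.adjoin ℚ {ξ} := by
    have hw' : i w ∈ IntermediateField.adjoin ℚ {i ξ} ↔ w ∈ IntermediateField.adjoin ℚ {ξ} := by
      rw [← Set.image_singleton, ← IntermediateField.adjoin_map]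
      constructor
      · rintro ⟨x, hx, hxw⟩
        rwa [hi hxw] at hx
      · exact fun h => ⟨w, h, rfl⟩
    rw [← hw']
    refine ⟨?_, fun h => ⟨i w, h, hwC⟩⟩
    rintro ⟨x, hx, hxw⟩
    rcases sq_eq_sq_iff_eq_or_eq_neg.1 (hwC.trans hxw.symm) with h | h
    · rwa [h]
    · rw [h]
      exact neg_mem hx
  let e : AddChar (ZMod n) Ω := AddChar.zmodChar n hξ.pow_eq_one
  have he1 : e 1 = ξ := by
    have := AddChar.zmodChar_apply' hξ.pow_eq_one 1
    simpa using this
  have hinj : Function.Injective e := fun k l h =>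
    ZMod.val_injective n (hξ.pow_inj (ZMod.val_lt k) (ZMod.val_lt l) h)
  have hsurj : ∀ x : Ω, x ^ n = 1 → ∃ k, e k = x := by
    intro x hx
    obtain ⟨i, -, rfl⟩ := hξ.eq_pow_of_pow_eq_one hx
    exact ⟨i, AddChar.zmodChar_apply' _ i⟩
  have hfix : ∀ σ : Gal(Ω/ℚ), σ ξ = ξ → w ∈ IntermediateField.adjoin ℚ {ξ} → σ w = w := by
    intro σ hσ hwmem
    exact (IntermediateField.forall_mem_adjoin_smul_eq_self_iff ℚ σ).2 (by simpa using hσ) w hwmem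
  have hce : ∀ k, c (e k) = e (((-1 : (ZMod n)ˣ) : ZMod n) * k) := by
    apply map_addChar_of_map_one
    rw [he1, Units.val_neg, Units.val_one, AddChar.map_neg_eq_inv, he1]
    apply hi
    rw [hcC, map_inv₀,
      Complex.inv_eq_conj ((hξ.map_of_injective hi).norm'_eq_one (NeZero.ne n))]
  have hconj := Complex.conj_eq_self_or_neg_of_sq_eq (w := i w) (m := (m : ℝ))
    (by rw [hwC]; simp)
  have hcpos : 0 < m → c w = w := fun h =>
    hi ((hcC w).trans (hconj.1 (by exact_mod_cast h)))
  have hcneg : m < 0 → c w = -w := fun h =>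
    hi (by rw [hcC, hconj.2 (by exact_mod_cast h), map_neg])
  obtain ⟨H, hφ, hb, hH⟩ := exists_affine_subgroup hodd hR hm hsR hirr h3 E hinj hsurj hw
  set T := H.map SemidirectProduct.rightHom with hTdef
  have hT : ∀ x, x ∈ T ∨ -x ∈ T := by
    intro x
    obtain ⟨σ, hσ⟩ := exists_gal_map_addChar hinj x
    obtain ⟨ε, hε⟩ := exists_sign_map_sqrt σ hw
    rcases Int.units_eq_one_or ε with rfl | rfl
    · exact Or.inl ((hH x).2 ⟨σ, x, 1, hσ, hε, by simp⟩)
    · exact Or.inr ((hH (-x)).2 ⟨σ, x, -1, hσ, hε, by simp⟩)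
  refine ⟨H, hφ, hb, hT, ?_, ?_⟩
  · rintro hcon ⟨hlt, hP⟩
    -- An automorphism that fixes the roots of unity cannot negate `w`.
    have key : ∀ σ : Gal(Ω/ℚ), σ ξ = ξ → σ w ≠ -w := fun σ h1 h2 =>
      hw0 ((hfix σ h1 (hmem.1 hP)).symm.trans h2)
    obtain ⟨σ, a, ε, ha, hε, hx⟩ := (hH _).1 hcon
    have haξ : σ ξ = e a := by rw [← he1, ha, mul_one]
    rcases Int.units_eq_one_or ε with rfl | rfl
    · have ha1 : (a : ZMod n) = -1 := by simpa using hx.symm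
      refine key (σ * c) ?_ ?_
      · rw [AlgEquiv.mul_apply, ← he1, hce, ha, ha1]
        simp
      · rw [AlgEquiv.mul_apply, hcneg hlt, map_neg, hε]
        simp
    · have ha1 : (a : ZMod n) = 1 := by simpa using hx.symm
      refine key σ ?_ (by simpa using hε)
      rw [haξ, ha1, he1]
  · intro hcond
    rcases lt_or_gt_of_ne hm.ne_zero with hlt | hgt
    · obtain ⟨σ, hσ, hσw⟩ := exists_gal_fix_ne_of_notMem_adjoin fun h =>
        hcond ⟨hlt, hmem.2 h⟩
      obtain ⟨ε, hε⟩ := exists_sign_map_sqrt σ hw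
      rcases Int.units_eq_one_or ε with rfl | rfl
      · exact absurd (by simpa using hε) hσw
      · refine (hH _).2 ⟨σ, 1, -1, map_addChar_of_map_one σ ?_, hε, by simp⟩
        simpa [he1] using hσ
    · exact (hH _).2 ⟨c, -1, 1, hce, by simpa using hcpos hgt, by simp⟩

/-! ### The Galois group of the De Moivre polynomial -/

theorem theorem1 (n : ℕ) (hn : 3 ≤ n) (hodd : Odd n) (d R : ℚ) (hd : d ≠ 0) (hR : ¬ IsSquare R)
    (s : ℚ) (R' : ℤ) (hR' : Squarefree R') (hsR : R = s ^ 2 * (R' : ℚ))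
    (ζ : ℂ) (hζ : IsPrimitiveRoot ζ n)
    (hirr : Irreducible (deMoivre n d R)) (h3 : 3 ∣ n → R' ≠ -3) :
    (¬ (R' < 0 ∧ ∃ w ∈ IntermediateField.adjoin ℚ {ζ}, w ^ 2 = (R' : ℂ)) →
      Nonempty (Gal(splittingFieldIn (deMoivre n d R)/ℚ) ≃*
        Multiplicative (ZMod n) ⋊[unitsAct n] (ZMod n)ˣ)) ∧
    ((R' < 0 ∧ ∃ w ∈ IntermediateField.adjoin ℚ {ζ}, w ^ 2 = (R' : ℂ)) →
      ∃ t : (ZMod n)ˣ ⧸ Subgroup.zpowers (-1 : (ZMod n)ˣ) →* (ZMod n)ˣ,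
        (∀ a, (QuotientGroup.mk (t a) : (ZMod n)ˣ ⧸ Subgroup.zpowers (-1 : (ZMod n)ˣ)) = a) ∧
        Nonempty (Gal(splittingFieldIn (deMoivre n d R)/ℚ) ≃*
          Multiplicative (ZMod n) ⋊[(unitsAct n).comp t]
            ((ZMod n)ˣ ⧸ Subgroup.zpowers (-1 : (ZMod n)ˣ)))) := by
  have : NeZero n := ⟨by omega⟩
  have : (deMoivre n d R).IsSplittingField ℚ (splittingFieldIn (deMoivre n d R)) :=
    IntermediateField.adjoin_rootSet_isSplittingField (IsAlgClosed.splits _)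
  let A := algebraicClosure ℚ ℂ
  have : IsAlgClosure ℚ A := algebraicClosure.isAlgClosure ℚ ℂ
  have : IsAlgClosed A := IsAlgClosure.isAlgClosed ℚ
  have : Normal ℚ A := IsAlgClosure.normal ℚ A
  have : IsGalois ℚ A := {}
  obtain ⟨ξ, rfl⟩ : ∃ ξ : A, A.val ξ = ζ :=
    ⟨⟨ζ, mem_algebraicClosure_iff.2 (hζ.isIntegral (NeZero.pos n)).tower_top.isAlgebraic⟩, rfl⟩
  obtain ⟨H, ⟨φ⟩, hb, hT, hneg⟩ := exists_affine_subgroup_of_embedding A.val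
    (AlgEquiv.restrictNormal_commutes (Complex.conjAe.restrictScalars ℚ) A) hodd hR hR' hsR hirr h3
    (splittingFieldIn (deMoivre n d R)) (hζ.of_map_of_injective A.val.injective)
  constructor
  · intro hcond
    have hTtop : H.map SemidirectProduct.rightHom = ⊤ := (Subgroup.eq_top_iff' _).2 fun x =>
      (hT x).elim id fun h => by simpa using Subgroup.mul_mem _ (hneg.2 hcond) h
    obtain ⟨χ⟩ := AffineZMod.nonempty_mulEquiv hb (MonoidHom.id (ZMod n)ˣ) Function.injective_id
      ((MonoidHom.range_eq_top.2 Function.surjective_id).trans hTtop.symm)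
    exact ⟨φ.trans χ⟩
  · intro hcond
    obtain ⟨t, ht, htr⟩ := exists_section_of_neg_one_notMem _ hT fun h => hneg.1 h hcond
    obtain ⟨χ⟩ := AffineZMod.nonempty_mulEquiv hb t
      (Function.LeftInverse.injective (g := fun x => QuotientGroup.mk x) ht) htr
    exact ⟨t, ht, ⟨φ.trans χ⟩⟩
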